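/- Let $\mathcal L\supseteq\{0,1,+,\cdot,<\}$ be a first-order language and let $T$ be a complete, model complete, o-minimal, power bounded $\mathcal L$-theory extending the theory of real closed ordered fields. (Power bounded: in every model, each function $K\to K$ definable with parameters is eventually bounded in absolute value by a power function, i.e. a definable endomorphism of the multiplicative group $K^{>0}$.) Let $K\models T$ be equipped with - a proper $T$-convex valuation ring $\mathcal O$, i.e. a proper convex nonempty subset $\mathcal O\subsetneq K$ with $F(\mathcal O)\subseteq\mathcal O$ for every $\mathcal L(\emptyset)$-definable continuous $F\colon K\to K$; let $\mathcal o$ be its maximal ideal, $v\colon K\to\Gamma\cup\{\infty\}$ its valuation, and $\boldsymbol k=\mathcal O/\mathcal o$; - a $T$-derivation $\partial\colon K\to K$, i.e. $\partial(F(u))=\sum_i\frac{\partial F}{\partial Y_i}(u)\,\partial u_i$ for every $\mathcal L(\emptyset)$-definable $\mathcal C^1$-function $F\colon U\to K$ with $U\subseteq K^n$ open and all $u\in U$, that is small: $\partial\mathcal o\subseteq\mathcal o$. Then $\partial\mathcal O\subseteq\mathcal O$, and $\boldsymbol k$ carries the induced derivation. A differential field is linearly surjective if every nonzero linear differential operator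 $a_0+a_1\partial+\dots+a_r\partial^r$ over it is surjective. $K$ is spherically complete if every nonempty collection of closed $v$-balls $\{b: v(b-a)\ge\gamma\}$ ($a\in K$, $\gamma\in\Gamma\cup\{\infty\}$), any two of which meet, has nonempty intersection. For $A=\sum_i a_i\partial^i\in K[\partial]$ put $vA=\min_i va_i$, and for $g\in K$ let $A_{\times g}$ be the operator with $A_{\times g}(y)=A(gy)$ (with coefficients given by the Leibniz rule). Write $J^r(a)=(a,\partial a,\dots,\partial^r a)$. A nonzero $A$ linearly approximates $F\colon K^{1+r}\to K$ on $B\subseteq K$ if $v\big(F(J^r b)-F(J^r a)-A(b-a)\big)>vA_{\times(b-a)}$ for all distinct $a,b\in B$. $F$ is in implicit form if $F=m\,(Y_r-I(Y_0,\dots,Y_{r-1}))$ with $m\in K^\times$ and $I\colon K^r\to K$ an $\mathcal L(K)$-definable function. Finally, $K$ is $T^\partial$-henselian if 1. $\boldsymbol k$ is linearly surjective; and 2. for all $r\in\mathbb N$, all $F\colon K^{1+r}\to K$ in implicit form and all $A\in K[\partial]$ such that $A$ linearly approximates $F$ on $\mathcal o$ and $vF(0,\dots,0)>vA$, there is $\epsilon\in\mathcal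 o$ with $F(J^r\epsilon)=0$ and $vA_{\times\epsilon}\ge vF(0,\dots,0)$. **Statement.** If the differential residue field $\boldsymbol k$ is linearly surjective and $K$ is spherically complete, then $K$ is $T^\partial$-henselian. -/

import Mathlib

open Set Filter Topology FirstOrder

universe u v w

noncomputable section

namespace TConvex

/-! ### First-order theories of real closed ordered fields -/

/-- The symbols `0, 1, +, ·, <` inside a first-order language `L`. -/
structure OrderedRingSymbols (L : FirstOrder.Language.{u, v}) where
  zero : L.Functions 0
  one : L.Functions 0
  add : L.Functions 2
  mul : L.Functions 2
  lt : L.Relations 2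

/-- The field operations and the order of `M` are the interpretations of the distinguished symbols
in the `L`-structure `M`. -/
structure OrderedRingSymbols.Compatible {L : FirstOrder.Language.{u, v}} (S : OrderedRingSymbols L)
    (M : Type w) [Field M] [LinearOrder M] [L.Structure M] : Prop where
  zero_eq : FirstOrder.Language.Structure.funMap S.zero ![] = (0 : M)
  one_eq : FirstOrder.Language.Structure.funMap S.one ![] = (1 : M)
  add_eq : ∀ a b : M, FirstOrder.Language.Structure.funMap S.add ![a, b] = a + b
  mul_eq : ∀ a b : M, FirstOrder.Language.Structure.funMap S.mul ![a, b] = a * b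
  lt_iff : ∀ a b : M, FirstOrder.Language.Structure.RelMap S.lt ![a, b] ↔ a < b

/-- `T` extends the theory of real closed ordered fields: every model of `T` is a real closed
ordered field with respect to the interpretations of the distinguished symbols. -/
def ExtendsRCOF {L : FirstOrder.Language.{u, v}} (S : OrderedRingSymbols L) (T : L.Theory) : Prop :=
  ∀ M : FirstOrder.Language.Theory.ModelType.{u, v, max u v w} T, ∃ (_ : Field M) (_ : LinearOrder M),
    IsStrictOrderedRing M ∧ IsRealClosed M ∧ S.Compatible M

/-- `T` is model complete: every `L`-embedding between models of `T` is elementary. -/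
def IsModelComplete {L : FirstOrder.Language.{u, v}} (T : L.Theory) : Prop :=
  ∀ (M N : FirstOrder.Language.Theory.ModelType.{u, v, max u v w} T) (f : M ↪[L] N) (n : ℕ)
    (φ : L.Formula (Fin n)) (x : Fin n → M), φ.Realize (f ∘ x) ↔ φ.Realize x

/-- Points and open intervals with endpoints in `M ∪ {-∞, +∞}`. -/
def IsPointOrInterval {M : Type w} [LinearOrder M] (I : Set M) : Prop :=
  (∃ a, I = {a}) ∨ (∃ a b, I = Ioo a b) ∨ (∃ a, I = Ioi a) ∨ (∃ a, I = Iio a) ∨ I = univ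

/-- The `L`-structure on the linearly ordered set `M` is o-minimal: every subset of `M` that is
definable with parameters is a finite union of points and open intervals. -/
def IsOMinimalStructure (L : FirstOrder.Language.{u, v}) (M : Type w) [LinearOrder M] [L.Structure M] :
    Prop :=
  ∀ X : Set M, (univ : Set M).Definable₁ L X →
    ∃ 𝓕 : Set (Set M), 𝓕.Finite ∧ (∀ I ∈ 𝓕, IsPointOrInterval I) ∧ X = ⋃₀ 𝓕

/-- Every model of `T` is o-minimal. -/
def IsOMinimal {L : FirstOrder.Language.{u, v}} (S : OrderedRingSymbols L) (T : L.Theory) : Prop :=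
  ∀ (M : FirstOrder.Language.Theory.ModelType.{u, v, max u v w} T) [Field M] [LinearOrder M],
    S.Compatible M → IsOMinimalStructure L M

/-- `p` restricts to a power function: an endomorphism of the multiplicative group of positive
elements that is definable with parameters. (The values of `p` at non-positive arguments play no
role.) -/
def IsPowerFunction (L : FirstOrder.Language.{u, v}) {M : Type w} [Field M] [LinearOrder M] [L.Structure M]
    (p : M → M) : Prop :=
  (∀ x, 0 < x → 0 < p x) ∧ (∀ x y, 0 < x → 0 < y → p (x * y) = p x * p y) ∧
    (univ : Set M).Definable L {z : Fin 2 → M | 0 < z 0 ∧ z 1 = p (z 0)}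

/-- Every function `M → M` that is definable with parameters is eventually bounded by a power
function. -/
def IsPowerBoundedStructure (L : FirstOrder.Language.{u, v}) (M : Type w) [Field M] [LinearOrder M]
    [L.Structure M] : Prop :=
  ∀ f : M → M, (univ : Set M).DefinableFun L (fun z : Fin 1 → M => f (z 0)) →
    ∃ p : M → M, IsPowerFunction L p ∧ ∀ᶠ x in atTop, |f x| ≤ p x

/-- Every model of `T` is power bounded. -/
def IsPowerBounded {L : FirstOrder.Language.{u, v}} (S : OrderedRingSymbols L) (T : L.Theory) : Prop :=
  ∀ (M : FirstOrder.Language.Theory.ModelType.{u, v, max u v w} T) [Field M] [LinearOrder M],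
    S.Compatible M → IsPowerBoundedStructure L M

/-! ### `T`-convex valuation rings and `T`-derivations -/

/-- A subset `O` of `K` is `T`-convex: it is convex, nonempty and closed under all continuous
functions `K → K` that are definable without parameters. -/
structure IsTConvex (L : FirstOrder.Language.{u, v}) {K : Type w} [LinearOrder K] [TopologicalSpace K]
    [L.Structure K] (O : Set K) : Prop where
  ordConnected : O.OrdConnected
  nonempty : O.Nonempty
  map_mem : ∀ F : K → K, (∅ : Set K).DefinableFun L (fun z : Fin 1 → K => F (z 0)) →
    Continuous F → ∀ a ∈ O, F a ∈ O

/-- `F` has partial derivative `d` at `x` with respect to the `i`-th variable. -/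
def HasPartialDerivAt {K : Type w} [Field K] [TopologicalSpace K] {n : ℕ}
    (F : (Fin n → K) → K) (d : K) (x : Fin n → K) (i : Fin n) : Prop :=
  Tendsto (fun h : K => (F (x + Pi.single i h) - F x) / h) (𝓝[≠] 0) (𝓝 d)

/-- `δ` is a `T`-derivation: `δ (F x) = ∑ i, ∂F/∂Yᵢ (x) * δ (xᵢ)` for all `x ∈ U`, for every
`C¹`-function `F : U → K` on an open set `U ⊆ Kⁿ` that is definable without parameters. Here `D i`
is the `i`-th partial derivative of `F`; the values of `F` and `D i` outside `U` play no role. -/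
def IsTDerivation (L : FirstOrder.Language.{u, v}) {K : Type w} [Field K] [TopologicalSpace K]
    [L.Structure K] (δ : K → K) : Prop :=
  ∀ (n : ℕ) (U : Set (Fin n → K)) (F : (Fin n → K) → K) (D : Fin n → (Fin n → K) → K),
    IsOpen U →
    (∅ : Set K).Definable L
      {z : Fin (n + 1) → K | Fin.init z ∈ U ∧ z (Fin.last n) = F (Fin.init z)} →
    (∀ x ∈ U, ∀ i, HasPartialDerivAt F (D i x) x i) →
    ContinuousOn F U → (∀ i, ContinuousOn (D i) U) →
    ∀ x ∈ U, δ (F x) = ∑ i, D i x * δ (x i)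

/-! ### Linear differential operators -/

/-- The operator `y ↦ a₀ y + a₁ δ y + ⋯ + aᵣ δʳ y` given by the finitely supported sequence `A` of
coefficients. An element `a₀ + a₁ ∂ + ⋯ + aᵣ ∂ʳ` of the ring of linear differential operators is
identified with its sequence of coefficients. -/
def opApply {F : Type w} [Field F] (δ : F → F) (A : ℕ →₀ F) (y : F) : F :=
  A.sum fun i a => a * δ^[i] y

/-- Every nonzero linear differential operator over `F` is surjective. -/
def IsLinearlySurjective {F : Type w} [Field F] (δ : F → F) : Prop :=
  ∀ A : ℕ →₀ F, A ≠ 0 → Function.Surjective (opApply δ A)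

/-- The multiplicative conjugate `A_{×g} = A g`, that is, `∑ i, aᵢ ∂ⁱ g` written as
`∑ j, (∑ i ≥ j, aᵢ (i choose j) g^{(i-j)}) ∂ʲ`. -/
def mulConj {F : Type w} [Field F] (δ : F → F) (A : ℕ →₀ F) (g : F) : ℕ →₀ F :=
  A.sum fun i a => ∑ j ∈ Finset.range (i + 1),
    Finsupp.single j (a * (i.choose j : F) * δ^[i - j] g)

theorem iterate_mul {F : Type w} [Field F] (δ : Derivation ℤ F F) (g y : F) (n : ℕ) :
    δ^[n] (g * y) = ∑ j ∈ Finset.range (n + 1), (n.choose j : F) * δ^[n - j] g * δ^[j] y := by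
  induction n with
  | zero => simp
  | succ n ih =>
    have h := Finset.sum_antidiagonal_choose_succ_mul
      (fun i j => δ^[j] g * δ^[i] y) n
    rw [Finset.Nat.sum_antidiagonal_eq_sum_range_succ_mk,
      Finset.Nat.sum_antidiagonal_eq_sum_range_succ_mk,
      Finset.Nat.sum_antidiagonal_eq_sum_range_succ_mk] at h
    rw [Function.iterate_succ_apply', ih, map_sum]
    simp only [mul_assoc]
    rw [h, ← Finset.sum_add_distrib]
    refine Finset.sum_congr rfl fun j hj => ?_
    have hj' : j ≤ n := Nat.lt_succ_iff.mp (Finset.mem_range.mp hj)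
    rw [Derivation.leibniz, Derivation.leibniz, Derivation.map_natCast, Nat.choose_symm hj']
    simp only [smul_eq_mul, Function.iterate_succ_apply', mul_zero, add_zero]
    ring

/-- `A_{×g}(y) = A(g y)`. -/
theorem opApply_mulConj {F : Type w} [Field F] (δ : Derivation ℤ F F) (A : ℕ →₀ F) (g y : F) :
    opApply δ (mulConj δ A g) y = opApply δ A (g * y) := by
  have hz : ∀ i : ℕ, (0 : F) * δ^[i] y = 0 := fun i => zero_mul _
  have ha : ∀ (i : ℕ) (b c : F), (b + c) * δ^[i] y = b * δ^[i] y + c * δ^[i] y :=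
    fun i b c => add_mul _ _ _
  unfold opApply mulConj
  rw [Finsupp.sum_sum_index hz ha]
  refine Finsupp.sum_congr fun i _ => ?_
  rw [← Finsupp.sum_finsetSum_index hz ha, iterate_mul, Finset.mul_sum]
  refine Finset.sum_congr rfl fun j _ => ?_
  rw [Finsupp.sum_single_index (hz j)]
  ring

/-! ### Valued differential fields with small derivation

For a valuation subring `O` of `K`, Mathlib's valuation `O.valuation` is written multiplicatively
and with the order of the value group reversed: `v a > v b` reads `O.valuation a < O.valuation b`,
and `v 0 = ∞` reads `O.valuation 0 = 0`. -/

section Valued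

variable {K : Type w} [Field K]

/-- Small derivation: the maximal ideal of `O` is closed under `δ`. -/
def IsSmall (O : ValuationSubring K) (δ : K → K) : Prop :=
  ∀ a : K, O.valuation a < 1 → O.valuation (δ a) < 1

theorem IsSmall.map_mem {O : ValuationSubring K} {δ : Derivation ℤ K K} (h : IsSmall O δ) {a : K}
    (ha : a ∈ O) : δ a ∈ O := by
  by_contra hn
  have h1 : 1 < O.valuation (δ a) := by
    rw [← not_le, O.valuation_le_one_iff]; exact hn
  have h0 : δ a ≠ 0 := fun h0 => hn (h0 ▸ O.zero_mem)
  have hg : O.valuation (δ a)⁻¹ < 1 := by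
    rw [map_inv₀]; exact inv_lt_one_of_one_lt₀ h1
  have ha1 : O.valuation a ≤ 1 := (O.valuation_le_one_iff a).2 ha
  have e : δ (a * (δ a)⁻¹) = a * δ (δ a)⁻¹ + 1 := by
    rw [Derivation.leibniz, smul_eq_mul, smul_eq_mul, inv_mul_cancel₀ h0]
  have h2 : O.valuation (a * (δ a)⁻¹) < 1 := by
    rw [map_mul]; exact mul_lt_one_of_nonneg_of_lt_one_right ha1 zero_le hg
  have h3 : O.valuation (a * δ (δ a)⁻¹) < 1 := by
    rw [map_mul]; exact mul_lt_one_of_nonneg_of_lt_one_right ha1 zero_le (h _ hg)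
  have h4 : O.valuation (1 : K) < 1 := by
    have : (1 : K) = δ (a * (δ a)⁻¹) - a * δ (δ a)⁻¹ := by rw [e]; ring
    rw [this]
    exact (O.valuation.map_sub _ _).trans_lt (max_lt (h _ h2) h3)
  simp at h4

theorem IsSmall.residue_eq {O : ValuationSubring K} {δ : Derivation ℤ K K} (h : IsSmall O δ)
    {a b : O} (hab : IsLocalRing.residue O a = IsLocalRing.residue O b) :
    IsLocalRing.residue O ⟨δ a, h.map_mem a.2⟩ = IsLocalRing.residue O ⟨δ b, h.map_mem b.2⟩ := by
  rw [← sub_eq_zero, ← map_sub, IsLocalRing.residue_eq_zero_iff, O.valuation_lt_one_iff] at hab ⊢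
  have := h _ hab
  simpa using this

/-- The derivation induced on the residue field by a small derivation. -/
def residueMap (O : ValuationSubring K) (δ : Derivation ℤ K K) (h : IsSmall O δ) :
    IsLocalRing.ResidueField O → IsLocalRing.ResidueField O :=
  fun x =>
    let a : O := Function.surjInv (IsLocalRing.residue_surjective (R := O)) x
    IsLocalRing.residue O ⟨δ a, h.map_mem a.2⟩

theorem residueMap_residue {O : ValuationSubring K} {δ : Derivation ℤ K K} (h : IsSmall O δ)
    (a : O) :
    residueMap O δ h (IsLocalRing.residue O a) = IsLocalRing.residue O ⟨δ a, h.map_mem a.2⟩ :=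
  h.residue_eq (Function.surjInv_eq (IsLocalRing.residue_surjective (R := O)) _)

/-- The valuation `v A = min v aᵢ` of a linear differential operator. -/
def opValuation (O : ValuationSubring K) (A : ℕ →₀ K) : O.ValueGroup :=
  A.support.sup fun i => O.valuation (A i)

/-- `K` is spherically complete: every nonempty nested collection of closed balls
`{b | v (b - a) ≥ γ}`, where `γ` may be `∞`, has nonempty intersection. -/
def IsSphericallyComplete (O : ValuationSubring K) : Prop :=
  ∀ 𝓑 : Set (Set K), 𝓑.Nonempty →
    (∀ B ∈ 𝓑, ∃ (a : K) (γ : O.ValueGroup), B = {b | O.valuation (b - a) ≤ γ}) →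
    (∀ B ∈ 𝓑, ∀ B' ∈ 𝓑, (B ∩ B').Nonempty) →
    (⋂₀ 𝓑).Nonempty

/-- The jet `(a, δ a, …, δʳ a)`. -/
def jet (δ : K → K) (r : ℕ) (a : K) : Fin (r + 1) → K := fun i => δ^[i] a

/-- The nonzero operator `A` linearly approximates `F : K^{1+r} → K` on `B`. -/
def LinearlyApproximates (O : ValuationSubring K) (δ : K → K) {r : ℕ}
    (F : (Fin (r + 1) → K) → K) (A : ℕ →₀ K) (B : Set K) : Prop :=
  A ≠ 0 ∧ ∀ a ∈ B, ∀ b ∈ B, a ≠ b →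
    O.valuation (F (jet δ r b) - F (jet δ r a) - opApply δ A (b - a)) <
      opValuation O (mulConj δ A (b - a))

/-- `F = m (Yᵣ - I(Y₀, …, Yᵣ₋₁))` with `m ≠ 0` and `I` definable with parameters. Such an `F` is
itself definable with parameters. -/
def IsImplicitForm (L : FirstOrder.Language.{u, v}) [L.Structure K] {r : ℕ} (F : (Fin (r + 1) → K) → K) :
    Prop :=
  ∃ (m : K) (I : (Fin r → K) → K), m ≠ 0 ∧ (univ : Set K).DefinableFun L I ∧
    ∀ y, F y = m * (y (Fin.last r) - I (Fin.init y))

/-- `T^∂`-henselianity of a valued field with a small derivation. -/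
structure IsTDHenselian (L : FirstOrder.Language.{u, v}) [L.Structure K] (O : ValuationSubring K)
    (δ : Derivation ℤ K K) (h : IsSmall O δ) : Prop where
  linearlySurjective : IsLinearlySurjective (residueMap O δ h)
  exists_zero : ∀ (r : ℕ) (F : (Fin (r + 1) → K) → K) (A : ℕ →₀ K), IsImplicitForm L F →
    LinearlyApproximates O δ F A {a | O.valuation a < 1} →
    O.valuation (F 0) < opValuation O A →
    ∃ ε : K, O.valuation ε < 1 ∧ F (jet δ r ε) = 0 ∧
      opValuation O (mulConj δ A ε) ≤ O.valuation (F 0)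

end Valued

end TConvex

end

noncomputable section

namespace TConvex

/-! ### Norms of operators as maxima over the valuation ring -/

section Norm

variable {K : Type w} [Field K]

/-! The zero is found by Newton approximation, continued transfinitely through spherical
completeness. Write |·| for `O.valuation`, so that small elements have small |·|. Linear
surjectivity of the residue field lets A(u) = f be solved with an error below |A| whenever |f| ≤ |A|
(`exists_opApply_sub_lt`), so |A| is the maximum of |A(u)| over |u| ≤ 1. Hence N(g) = |A_{×g}| is
the maximum of |A(y)| over |y| ≤ |g|; it depends only on |g| and is strictly increasing in it. If
N(g) = |F(Jʳa)|, solving A(gu) ≈ -F(Jʳa) gives a better approximate zero a + gu. Zorn's lemma then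
yields a zero, chains being bounded by points common to nested balls.

The crux is that N attains every nonzero value (`exists_opValuation_mulConj_eq`). Conjugation by x⁻¹
replaces ∂ by ∂ - s, where s = δx/x, up to the factor x⁻¹. Let B_s be the resulting operator and
choose b(s) with |f||b(s)| = |B_s|; the requirement is |x| = |b(δx/x)|, which x = b(s) meets once s
is fixed modulo O by s ↦ δb(s)/b(s). Moving s by at most |τ|, where |τ| ≥ 1, changes |B_s| by a
factor at most |τ|^r, while an infinite logarithmic derivative of x cannot have a power bounding
both |x| and |x⁻¹| (`IsSmall.false_of_le_pow_logDeriv`). So the map contracts distances modulo O,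
and spherical completeness gives the fixed point. -/

theorem opApply_add {F : Type w} [Field F] (D : F → F) (A B : ℕ →₀ F) (y : F) :
    opApply D (A + B) y = opApply D A y + opApply D B y :=
  Finsupp.sum_add_index' (fun _ => zero_mul _) fun _ _ _ => add_mul _ _ _

theorem opApply_smul {F : Type w} [Field F] (D : F → F) (c : F) (A : ℕ →₀ F) (y : F) :
    opApply D (c • A) y = c * opApply D A y := by
  unfold opApply
  rw [Finsupp.sum_smul_index fun _ => zero_mul _, Finsupp.mul_sum]
  simp only [mul_assoc]

theorem valuation_le_opValuation (O : ValuationSubring K) (A : ℕ →₀ K) (i : ℕ) :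
    O.valuation (A i) ≤ opValuation O A := by
  by_cases hi : i ∈ A.support
  · exact Finset.le_sup (f := fun i => O.valuation (A i)) hi
  · rw [Finsupp.notMem_support_iff.1 hi, map_zero]; exact zero_le

theorem exists_valuation_eq_opValuation (O : ValuationSubring K) {A : ℕ →₀ K} (hA : A ≠ 0) :
    ∃ i, A i ≠ 0 ∧ O.valuation (A i) = opValuation O A := by
  obtain ⟨i, hi, h⟩ := Finset.exists_mem_eq_sup A.support (Finsupp.support_nonempty_iff.2 hA)
    fun i => O.valuation (A i)
  exact ⟨i, Finsupp.mem_support_iff.1 hi, h.symm⟩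

theorem opValuation_zero (O : ValuationSubring K) : opValuation O 0 = 0 := by
  simp only [opValuation, Finsupp.support_zero, Finset.sup_empty]
  exact le_antisymm bot_le zero_le

theorem opValuation_ne_zero (O : ValuationSubring K) {A : ℕ →₀ K} (hA : A ≠ 0) :
    opValuation O A ≠ 0 := by
  obtain ⟨i, hi, h⟩ := exists_valuation_eq_opValuation O hA
  rw [← h]; exact (O.valuation.ne_zero_iff).2 hi

/-- A bound for the values of an operator from a bound for the iterates. -/
theorem valuation_opApply_le (O : ValuationSubring K) (D : K → K) (A : ℕ →₀ K) (y : K)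
    {c : O.ValueGroup} (h : ∀ i ∈ A.support, O.valuation (D^[i] y) ≤ c) :
    O.valuation (opApply D A y) ≤ opValuation O A * c := by
  refine Valuation.map_sum_le _ fun i hi => ?_
  rw [map_mul]
  exact mul_le_mul' (valuation_le_opValuation O A i) (h i hi)

variable {O : ValuationSubring K} {δ : Derivation ℤ K K}

theorem IsSmall.iterate_mem (h : IsSmall O δ) {a : K} (ha : a ∈ O) (n : ℕ) : δ^[n] a ∈ O := by
  induction n with
  | zero => exact ha
  | succ n ih => rw [Function.iterate_succ_apply']; exact h.map_mem ih

theorem IsSmall.iterate_lt (h : IsSmall O δ) {a : K} (ha : O.valuation a < 1) (n : ℕ) :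
    O.valuation (δ^[n] a) < 1 := by
  induction n with
  | zero => exact ha
  | succ n ih => rw [Function.iterate_succ_apply']; exact h _ ih

theorem IsSmall.valuation_map_le (h : IsSmall O δ) {a : K} (ha : O.valuation a ≤ 1) :
    O.valuation (δ a) ≤ 1 :=
  (O.valuation_le_one_iff _).2 (h.map_mem ((O.valuation_le_one_iff a).1 ha))

theorem IsSmall.opApply_le (h : IsSmall O δ) (A : ℕ →₀ K) {y : K} (hy : O.valuation y ≤ 1) :
    O.valuation (opApply δ A y) ≤ opValuation O A := by
  have := valuation_opApply_le O δ A y (c := 1) fun i _ =>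
    (O.valuation_le_one_iff _).2 (h.iterate_mem ((O.valuation_le_one_iff y).1 hy) i)
  rwa [mul_one] at this

theorem IsSmall.opApply_lt (h : IsSmall O δ) {A : ℕ →₀ K} (hA : A ≠ 0) {y : K}
    (hy : O.valuation y < 1) : O.valuation (opApply δ A y) < opValuation O A := by
  have h0 := opValuation_ne_zero O hA
  refine Valuation.map_sum_lt _ h0 fun i _ => ?_
  rw [map_mul]
  calc O.valuation (A i) * O.valuation (δ^[i] y) ≤ opValuation O A * O.valuation (δ^[i] y) :=
        mul_le_mul_left (valuation_le_opValuation O A i) _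
    _ < opValuation O A := by
        have := mul_lt_mul_of_pos_left (h.iterate_lt hy i) (zero_lt_iff.2 h0)
        rwa [mul_one] at this

theorem residueMap_iterate (h : IsSmall O δ) (a : O) (n : ℕ) :
    (residueMap O δ h)^[n] (IsLocalRing.residue O a) =
      IsLocalRing.residue O ⟨δ^[n] a, h.iterate_mem a.2 n⟩ := by
  induction n with
  | zero => rfl
  | succ n ih =>
    rw [Function.iterate_succ_apply', ih, residueMap_residue]
    congr 2
    exact (Function.iterate_succ_apply' _ _ _).symm

/-- Over a linearly surjective residue field, linear equations can be solved up to a smaller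
error. -/
theorem exists_opApply_sub_lt (h : IsSmall O δ) (hres : IsLinearlySurjective (residueMap O δ h))
    {A : ℕ →₀ K} (hA : A ≠ 0) {f : K} (hf : O.valuation f ≤ opValuation O A) :
    ∃ u : K, O.valuation u ≤ 1 ∧ O.valuation (opApply δ A u - f) < opValuation O A := by
  -- Dividing by a coefficient of maximal value makes `A` integral with m-th coefficient 1, so its
  -- reduction `R` is nonzero.
  obtain ⟨m, hm, hmA⟩ := exists_valuation_eq_opValuation O hA
  have hm0 : O.valuation (A m) ≠ 0 := (O.valuation.ne_zero_iff).2 hm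
  have hdiv : ∀ x : K, O.valuation x ≤ opValuation O A → x / A m ∈ O := fun x hx => by
    rw [← O.valuation_le_one_iff, map_div₀, hmA]
    exact div_le_one_of_le₀ hx zero_le
  let c : ℕ → O := fun i => ⟨A i / A m, hdiv _ (valuation_le_opValuation O A i)⟩
  let R : ℕ →₀ IsLocalRing.ResidueField O :=
    Finsupp.onFinset A.support (fun i => IsLocalRing.residue O (c i)) fun i hi => by
      rw [Finsupp.mem_support_iff]
      intro h0
      apply hi
      have : c i = 0 := Subtype.ext (by simp [c, h0])
      rw [this, map_zero]
  have hR : R ≠ 0 := fun h0 => by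
    have h1 : R m = 1 := by
      have : c m = 1 := Subtype.ext (by simp [c, hm])
      simp [R, this]
    rw [h0] at h1
    simp at h1
  obtain ⟨ub, hub⟩ := hres R hR (IsLocalRing.residue O ⟨f / A m, hdiv f hf⟩)
  obtain ⟨u, rfl⟩ := IsLocalRing.residue_surjective ub
  refine ⟨u, (O.valuation_le_one_iff _).2 u.2, ?_⟩
  have key : opApply (residueMap O δ h) R (IsLocalRing.residue O u) =
      IsLocalRing.residue O (∑ i ∈ A.support, c i * ⟨δ^[i] u, h.iterate_mem u.2 i⟩) := by
    unfold opApply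
    rw [Finsupp.onFinset_sum _ fun _ => zero_mul _, map_sum]
    refine Finset.sum_congr rfl fun i _ => ?_
    rw [residueMap_iterate, map_mul]
  rw [hub, eq_comm, ← sub_eq_zero, ← map_sub, IsLocalRing.residue_eq_zero_iff,
    O.valuation_lt_one_iff] at key
  have e : opApply δ A u - f = A m * (((∑ i ∈ A.support, c i * ⟨δ^[i] u, h.iterate_mem u.2 i⟩) -
      ⟨f / A m, hdiv f hf⟩ : O) : K) := by
    simp only [AddSubgroupClass.coe_sub, AddSubmonoidClass.coe_finsetSum, MulMemClass.coe_mul, c,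
      opApply, Finsupp.sum]
    rw [mul_sub, Finset.mul_sum, mul_div_cancel₀ _ hm]
    congr 1
    refine Finset.sum_congr rfl fun i _ => ?_
    field_simp
  rw [e, map_mul, ← hmA]
  have := mul_lt_mul_of_pos_left key (zero_lt_iff.2 hm0)
  rwa [mul_one] at this

/-- Over a linearly surjective residue field, the valuation of an operator is the maximal valuation
of its values on the valuation ring. -/
theorem isGreatest_opValuation (h : IsSmall O δ) (hres : IsLinearlySurjective (residueMap O δ h))
    (A : ℕ →₀ K) :
    IsGreatest ((fun u => O.valuation (opApply δ A u)) '' {u | O.valuation u ≤ 1})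
      (opValuation O A) := by
  refine ⟨?_, ?_⟩
  · rcases eq_or_ne A 0 with rfl | hA
    · exact ⟨0, by simp, by simp [opApply, opValuation_zero]⟩
    · obtain ⟨m, hm, hmA⟩ := exists_valuation_eq_opValuation O hA
      -- Aiming at `A m`, whose value is already maximal, makes the value at `u` exactly maximal.
      obtain ⟨u, hu, hlt⟩ := exists_opApply_sub_lt h hres hA hmA.le
      refine ⟨u, hu, ?_⟩
      rw [← hmA] at hlt ⊢
      exact (Valuation.map_eq_of_sub_lt _ hlt)
  · rintro _ ⟨u, hu, rfl⟩
    exact h.opApply_le A hu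

theorem opValuation_mulConj_zero (O : ValuationSubring K) (δ : Derivation ℤ K K) (A : ℕ →₀ K) :
    opValuation O (mulConj δ A 0) = 0 := by
  have h0 : ∀ n : ℕ, δ^[n] 0 = 0 := fun n => Function.iterate_fixed (map_zero δ) n
  simp [mulConj, h0, opValuation_zero]

theorem isGreatest_opValuation_mulConj (h : IsSmall O δ)
    (hres : IsLinearlySurjective (residueMap O δ h)) (A : ℕ →₀ K) (g : K) :
    IsGreatest ((fun u => O.valuation (opApply δ A (g * u))) '' {u | O.valuation u ≤ 1})
      (opValuation O (mulConj δ A g)) := by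
  simpa only [opApply_mulConj] using isGreatest_opValuation h hres (mulConj δ A g)

end Norm
-- Logarithmic derivatives under a small derivation
section LogDeriv

variable {K : Type w} [Field K] {O : ValuationSubring K} {δ : Derivation ℤ K K}

theorem derivation_inv (δ : Derivation ℤ K K) {a : K} (ha : a ≠ 0) :
    δ a⁻¹ = -(δ a / a * a⁻¹) := by
  have e : δ (a * a⁻¹) = 0 := by rw [mul_inv_cancel₀ ha]; exact δ.map_one_eq_zero
  rw [Derivation.leibniz, smul_eq_mul, smul_eq_mul] at e
  field_simp at e ⊢
  linear_combination e

theorem valuation_natCast_le_one (O : ValuationSubring K) (n : ℕ) : O.valuation (n : K) ≤ 1 :=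
  (O.valuation_le_one_iff _).2 (natCast_mem O n)

/-- Apply integrality of the derivation to a⁻¹, whose derivative is -(δa/a)a⁻¹. -/
theorem IsSmall.logDeriv_le (h : IsSmall O δ) {a : K} (ha : 1 ≤ O.valuation a) :
    O.valuation (δ a / a) ≤ O.valuation a := by
  have h0 : O.valuation a ≠ 0 := (zero_lt_one.trans_le ha).ne'
  have ha0 : a ≠ 0 := (O.valuation.ne_zero_iff).1 h0
  have h1 : O.valuation a⁻¹ ≤ 1 := by rw [map_inv₀]; exact inv_le_one_of_one_le₀ ha
  have h2 := h.valuation_map_le h1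
  rw [derivation_inv δ ha0, Valuation.map_neg, map_mul, map_inv₀] at h2
  exact by simpa using (mul_inv_le_iff₀ (zero_lt_iff.2 h0)).1 h2

theorem IsSmall.logDeriv_lt (h : IsSmall O δ) {a : K} (ha : 1 < O.valuation a) :
    O.valuation (δ a / a) < O.valuation a := by
  have h0 : O.valuation a ≠ 0 := (zero_lt_one.trans ha).ne'
  have ha0 : a ≠ 0 := (O.valuation.ne_zero_iff).1 h0
  have h1 : O.valuation a⁻¹ < 1 := by rw [map_inv₀]; exact inv_lt_one_of_one_lt₀ ha
  have h2 := h _ h1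
  rw [derivation_inv δ ha0, Valuation.map_neg, map_mul, map_inv₀] at h2
  exact by simpa using (mul_inv_lt_iff₀ (zero_lt_iff.2 h0)).1 h2

/-- Each application of δ to sⁿf multiplies it by nq + s, where q = δs/s. Since |q| < |s|, this
factor has value |s|, and smallness keeps the product in the maximal ideal. -/
theorem IsSmall.pow_logDeriv_mul_lt_one (h : IsSmall O δ) {f s : K} (hf : O.valuation f < 1)
    (hs : 1 < O.valuation s) (hd : δ f = s * f) (n : ℕ) :
    O.valuation s ^ n * O.valuation f < 1 := by
  have hs0 : s ≠ 0 := (O.valuation.ne_zero_iff).1 (zero_lt_one.trans hs).ne'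
  have hq := h.logDeriv_lt hs
  set q := δ s / s with hqdef
  have hsq : δ s = s * q := by rw [hqdef, mul_div_cancel₀ _ hs0]
  have hder : ∀ n : ℕ, δ (s ^ n * f) = s ^ n * f * (n * q + s) := fun n => by
    induction n with
    | zero => simp [hd, mul_comm]
    | succ n ih =>
      rw [pow_succ', mul_assoc, Derivation.leibniz, ih, hsq, smul_eq_mul, smul_eq_mul]
      push_cast
      ring
  have hval : ∀ n : ℕ, O.valuation (n * q + s) = O.valuation s := fun n => by
    refine Valuation.map_add_eq_of_lt_right O.valuation ?_
    rw [map_mul]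
    exact (mul_le_of_le_one_left' (valuation_natCast_le_one O n)).trans_lt hq
  have main : ∀ n : ℕ, O.valuation (s ^ n * f) < 1 := fun n => by
    induction n with
    | zero => simpa using hf
    | succ n ih =>
      have := h _ ih
      rw [hder, map_mul, hval, ← map_mul] at this
      rwa [pow_succ, mul_right_comm]
  simpa using main n

/-- The logarithmic derivative, if infinite, is infinitely smaller than the element itself on the
logarithmic scale. -/
theorem IsSmall.false_of_le_pow_logDeriv (h : IsSmall O δ) {x : K} (hx : x ≠ 0)
    (h1 : 1 < O.valuation (δ x / x)) {n : ℕ} (hle : O.valuation x ≤ O.valuation (δ x / x) ^ n)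
    (hle' : (O.valuation x)⁻¹ ≤ O.valuation (δ x / x) ^ n) : False := by
  have h0 : 0 < O.valuation x := zero_lt_iff.2 ((O.valuation.ne_zero_iff).2 hx)
  rcases lt_trichotomy (O.valuation x) 1 with hlt | heq | hgt
  · have := h.pow_logDeriv_mul_lt_one hlt h1 (div_mul_cancel₀ _ hx).symm n
    exact absurd ((inv_le_iff_one_le_mul₀ h0).1 hle') this.not_ge
  · rw [map_div₀, heq, div_one] at h1
    exact absurd (h.valuation_map_le heq.le) h1.not_ge
  -- The inverse lies in the maximal ideal and has logarithmic derivative -(δx/x), of the same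
  -- value.
  · have hinv : O.valuation x⁻¹ < 1 := by rw [map_inv₀]; exact inv_lt_one_of_one_lt₀ hgt
    have := h.pow_logDeriv_mul_lt_one (s := -(δ x / x)) hinv (by rwa [Valuation.map_neg])
      (by rw [derivation_inv δ hx]; ring) n
    rw [Valuation.map_neg, map_inv₀, mul_inv_lt_iff₀ h0, one_mul] at this
    exact absurd hle this.not_ge

end LogDeriv

/-! ### Additive conjugation of operators -/

section Twist

variable {K : Type w} [Field K] {O : ValuationSubring K} {δ : Derivation ℤ K K}

/-- The additive conjugate `y ↦ δ y - s y` of a derivation. -/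
def twist (δ : Derivation ℤ K K) (s y : K) : K := δ y - s * y

theorem twist_zero (δ : Derivation ℤ K K) : twist δ 0 = δ := by
  funext y; simp [twist]

/-- The twist sends τⁿu to τⁿ(n(δτ/τ)u + δu - tu). The bracket has value at most |τ| because |δτ/τ|
≤ |τ|, so each iteration costs one factor τ. -/
theorem IsSmall.exists_iterate_twist_eq (h : IsSmall O δ) {τ t y : K} (hτ : 1 ≤ O.valuation τ)
    (ht : O.valuation t ≤ O.valuation τ) (hy : O.valuation y ≤ 1) (n : ℕ) :
    ∃ u, O.valuation u ≤ 1 ∧ (twist δ t)^[n] y = τ ^ n * u := by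
  have hτ0 : 0 < O.valuation τ := zero_lt_one.trans_le hτ
  have hne : τ ≠ 0 := (O.valuation.ne_zero_iff).1 hτ0.ne'
  induction n with
  | zero => exact ⟨y, hy, by simp⟩
  | succ n ih =>
    obtain ⟨u, hu, he⟩ := ih
    refine ⟨(n * (δ τ / τ) * u + δ u - t * u) / τ, ?_, ?_⟩
    · rw [map_div₀]
      refine div_le_one_of_le₀ ((O.valuation.map_sub _ _).trans (max_le (Valuation.map_add_le _ ?_ ?_) ?_)) zero_le
      · rw [map_mul, map_mul]
        exact (mul_le_of_le_one_right' hu).trans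
          ((mul_le_of_le_one_left' (valuation_natCast_le_one O n)).trans (h.logDeriv_le hτ))
      · exact (h.valuation_map_le hu).trans hτ
      · rw [map_mul]
        exact (mul_le_of_le_one_right' hu).trans ht
    · have hpow : δ (τ ^ n) = τ ^ n * (n * (δ τ / τ)) := by
        clear he
        induction n with
        | zero => simp
        | succ n ih =>
          rw [pow_succ', Derivation.leibniz, ih, smul_eq_mul, smul_eq_mul]
          push_cast
          field_simp
      rw [Function.iterate_succ_apply', he, twist, Derivation.leibniz, hpow, smul_eq_mul,
        smul_eq_mul]
      field_simp
      ring

theorem IsSmall.opApply_twist_le (h : IsSmall O δ) {r : ℕ} {B : ℕ →₀ K}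
    (hB : B.support ⊆ Finset.range (r + 1)) {τ t y : K} (hτ : 1 ≤ O.valuation τ)
    (ht : O.valuation t ≤ O.valuation τ) (hy : O.valuation y ≤ 1) :
    O.valuation (opApply (twist δ t) B y) ≤ opValuation O B * O.valuation τ ^ r := by
  refine valuation_opApply_le O _ B y fun i hi => ?_
  obtain ⟨u, hu, he⟩ := h.exists_iterate_twist_eq hτ ht hy i
  rw [he, map_mul, map_pow]
  exact (mul_le_of_le_one_right' hu).trans
    (pow_le_pow_right₀ hτ (Nat.lt_succ_iff.1 (Finset.mem_range.1 (hB hi))))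

/-- The coefficients of `B` do not depend on t: t enters only through the derivation in which the
expansion is written. -/
theorem exists_iterate_twist_add (δ : Derivation ℤ K K) (s : K) (n : ℕ) :
    ∃ B : ℕ →₀ K, B.support ⊆ Finset.range (n + 1) ∧
      ∀ t y, (twist δ (s + t))^[n] y = opApply (twist δ t) B y := by
  induction n with
  | zero =>
    refine ⟨Finsupp.single 0 1, Finsupp.support_single_subset.trans (by simp), fun t y => ?_⟩
    simp [opApply]
  | succ n ih =>
    obtain ⟨B, hB, he⟩ := ih
    -- With D = `twist δ t`, applying D - s to bDⁱy gives δ(b)Dⁱy - sbDⁱy + bDⁱ⁺¹y.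
    refine ⟨Finsupp.mapRange δ (map_zero δ) B + (-s) • B + Finsupp.mapDomain Nat.succ B, ?_, ?_⟩
    · intro i hi
      rw [Finset.mem_range]
      by_contra hlt
      rw [not_lt] at hlt
      have hz : ∀ j, n + 1 ≤ j → B j = 0 := fun j hj => by
        by_contra hne
        have := Finset.mem_range.1 (hB (Finsupp.mem_support_iff.2 hne))
        omega
      obtain ⟨j, rfl⟩ : ∃ j, i = Nat.succ j := ⟨i - 1, by omega⟩
      rw [Finsupp.mem_support_iff] at hi
      apply hi
      simp only [Finsupp.add_apply, Finsupp.mapRange_apply, Finsupp.smul_apply,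
        Finsupp.mapDomain_apply Nat.succ_injective]
      rw [hz j (by omega), hz (Nat.succ j) (by omega)]
      simp
    · intro t y
      rw [Function.iterate_succ_apply', he, opApply_add, opApply_add, opApply_smul]
      have h1 : opApply (twist δ t) (Finsupp.mapRange δ (map_zero δ) B) y =
          B.sum fun i b => δ b * (twist δ t)^[i] y :=
        Finsupp.sum_mapRange_index fun _ => zero_mul _
      have h2 : opApply (twist δ t) (Finsupp.mapDomain Nat.succ B) y =
          B.sum fun i b => b * (twist δ t)^[i + 1] y :=
        Finsupp.sum_mapDomain_index (fun _ => zero_mul _) fun _ _ _ => add_mul _ _ _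
      rw [h1, h2, twist]
      simp only [opApply, Finsupp.sum, map_sum, Finset.mul_sum]
      rw [← Finset.sum_sub_distrib, ← Finset.sum_add_distrib, ← Finset.sum_add_distrib]
      refine Finset.sum_congr rfl fun i _ => ?_
      rw [Derivation.leibniz, Function.iterate_succ_apply', smul_eq_mul, smul_eq_mul]
      generalize (twist δ t)^[i] y = z
      simp only [twist]
      ring

theorem exists_opApply_twist_add (δ : Derivation ℤ K K) {r : ℕ} {A : ℕ →₀ K}
    (hA : A.support ⊆ Finset.range (r + 1)) (s : K) :
    ∃ B : ℕ →₀ K, B.support ⊆ Finset.range (r + 1) ∧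
      ∀ t y, opApply (twist δ (s + t)) A y = opApply (twist δ t) B y := by
  choose C hC hCe using exists_iterate_twist_add δ s
  refine ⟨∑ i ∈ A.support, A i • C i, ?_, fun t y => ?_⟩
  · refine Finsupp.support_finsetSum.trans (Finset.biUnion_subset.2 fun i hi => ?_)
    refine Finsupp.support_smul.trans ((hC i).trans (Finset.range_subset_range.2 ?_))
    exact Finset.mem_range.1 (hA hi)
  · have hsum : ∀ S : Finset ℕ, opApply (twist δ t) (∑ i ∈ S, A i • C i) y =
        ∑ i ∈ S, A i * opApply (twist δ t) (C i) y := fun S => by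
      induction S using Finset.induction_on with
      | empty => simp [opApply]
      | insert i S hi ih => rw [Finset.sum_insert hi, Finset.sum_insert hi, opApply_add,
          opApply_smul, ih]
    rw [hsum]
    refine Finset.sum_congr rfl fun i _ => ?_
    simp only [hCe]

theorem iterate_twist_logDeriv (δ : Derivation ℤ K K) {x : K} (hx : x ≠ 0) (y : K) (n : ℕ) :
    δ^[n] (x⁻¹ * y) = x⁻¹ * (twist δ (δ x / x))^[n] y := by
  induction n with
  | zero => rfl
  | succ n ih =>
    rw [Function.iterate_succ_apply', Function.iterate_succ_apply', ih, Derivation.leibniz,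
      derivation_inv δ hx, smul_eq_mul, smul_eq_mul, twist]
    ring

theorem opApply_inv_mul (δ : Derivation ℤ K K) (A : ℕ →₀ K) {x : K} (hx : x ≠ 0) (y : K) :
    opApply δ A (x⁻¹ * y) = x⁻¹ * opApply (twist δ (δ x / x)) A y := by
  simp only [opApply, Finsupp.mul_sum, iterate_twist_logDeriv δ hx]
  exact Finsupp.sum_congr fun i _ => by ring

end Twist
-- Every nonzero value is the norm of a conjugate
section Surjectivity

variable {K : Type w} [Field K] {O : ValuationSubring K} {δ : Derivation ℤ K K}

theorem logDeriv_div_eq_sub (δ : Derivation ℤ K K) {a b : K} (ha : a ≠ 0) (hb : b ≠ 0) :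
    δ (a / b) / (a / b) = δ a / a - δ b / b := by
  rw [div_eq_mul_inv a b, Derivation.leibniz, derivation_inv δ hb, smul_eq_mul, smul_eq_mul]
  field_simp
  ring

/-- In the spherically complete case with linearly surjective residue field, every value is attained
by the valuations of the multiplicative conjugates of a nonzero operator. -/
theorem exists_opValuation_mulConj_eq (h : IsSmall O δ)
    (hres : IsLinearlySurjective (residueMap O δ h)) (hsph : IsSphericallyComplete O)
    {A : ℕ →₀ K} (hA : A ≠ 0) {f : K} (hf : f ≠ 0) :
    ∃ g : K, g ≠ 0 ∧ opValuation O (mulConj δ A g) = O.valuation f := by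
  choose B hBs hB using
    exists_opApply_twist_add δ (Finset.subset_range_sup_succ A.support)
  set r := A.support.sup id
  have hB0 : ∀ s y, opApply (twist δ s) A y = opApply δ (B s) y := fun s y => by
    have := hB s 0 y
    rwa [add_zero, twist_zero] at this
  have hcmp : ∀ s s' τ : K, 1 ≤ O.valuation τ → O.valuation (s' - s) ≤ O.valuation τ →
      opValuation O (B s') ≤ opValuation O (B s) * O.valuation τ ^ r := by
    intro s s' τ hτ hs
    obtain ⟨u, hu, he⟩ := (isGreatest_opValuation h hres (B s')).1
    rw [← he]
    have e := hB s (s' - s) u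
    rw [add_sub_cancel, hB0] at e
    simp only [e]
    exact h.opApply_twist_le (hBs s) hτ hs hu
  -- Comparing `B s` with `B 0`, which acts as `A`, shows that a vanishing norm would force A = 0.
  have hne : ∀ s, opValuation O (B s) ≠ 0 := by
    intro s hs
    obtain ⟨u, hu, he⟩ := (isGreatest_opValuation h hres A).1
    apply opValuation_ne_zero O hA
    obtain ⟨τ, h1, h2⟩ : ∃ τ : K, 1 ≤ O.valuation τ ∧ O.valuation (0 - s) ≤ O.valuation τ := by
      rcases le_total 1 (O.valuation s) with h1 | h1
      · exact ⟨s, h1, by simp⟩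
      · exact ⟨1, by simp, by simpa using h1⟩
    have := hcmp s 0 τ h1 h2
    rw [hs, zero_mul] at this
    rw [← he, ← le_zero_iff]
    refine le_trans ?_ this
    have := h.opApply_le (B 0) hu
    rwa [← hB0, twist_zero] at this
  have hfv : O.valuation f ≠ 0 := (O.valuation.ne_zero_iff).2 hf
  have hex : ∀ s, ∃ b : K, O.valuation f * O.valuation b = opValuation O (B s) := fun s => by
    obtain ⟨b, hb⟩ := O.valuation_surjective (opValuation O (B s) / O.valuation f)
    exact ⟨b, by rw [hb, mul_div_cancel₀ _ hfv]⟩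
  choose b hb using hex
  have hb0 : ∀ s, b s ≠ 0 := fun s h0 => hne s (by rw [← hb, h0, map_zero, mul_zero])
  have hbv : ∀ s, 0 < O.valuation (b s) := fun s =>
    zero_lt_iff.2 ((O.valuation.ne_zero_iff).2 (hb0 s))
  have hbcmp : ∀ s s' τ : K, 1 ≤ O.valuation τ → O.valuation (s' - s) ≤ O.valuation τ →
      O.valuation (b s') ≤ O.valuation (b s) * O.valuation τ ^ r := by
    intro s s' τ hτ hs
    have := hcmp s s' τ hτ hs
    rw [← hb, ← hb, mul_assoc] at this
    exact le_of_mul_le_mul_left this (zero_lt_iff.2 hfv)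
  -- two elements `b s`, `b s'` cannot be far apart relative to their logarithmic derivatives
  have hfar : ∀ s s', 1 < O.valuation (δ (b s') / b s' - δ (b s) / b s) →
      O.valuation (s' - s) ≤ O.valuation (δ (b s') / b s' - δ (b s) / b s) → False := by
    intro s s' h1 h2
    rw [← logDeriv_div_eq_sub δ (hb0 s') (hb0 s)] at h1 h2
    refine h.false_of_le_pow_logDeriv (div_ne_zero (hb0 s') (hb0 s)) h1 (n := r) ?_ ?_
    · rw [map_div₀ _ (b s') (b s), div_le_iff₀ (hbv s), mul_comm]
      exact hbcmp s s' _ h1.le h2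
    · rw [map_div₀ _ (b s') (b s), inv_div, div_le_iff₀ (hbv s'), mul_comm]
      refine hbcmp s' s _ h1.le ?_
      rwa [Valuation.map_sub_swap]
  suffices H : ∃ x : K, x ≠ 0 ∧ O.valuation x = O.valuation (b (δ x / x)) by
    obtain ⟨x, hx, he⟩ := H
    have hxv : O.valuation x ≠ 0 := (O.valuation.ne_zero_iff).2 hx
    refine ⟨x⁻¹, inv_ne_zero hx, ?_⟩
    have e : ∀ u, O.valuation (opApply δ A (x⁻¹ * u)) =
        (O.valuation x)⁻¹ * O.valuation (opApply δ (B (δ x / x)) u) := fun u => by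
      rw [opApply_inv_mul δ A hx, map_mul, map_inv₀, hB0]
    have e2 : O.valuation f = (O.valuation x)⁻¹ * opValuation O (B (δ x / x)) := by
      rw [← hb, ← he, mul_comm (O.valuation f), inv_mul_cancel_left₀ hxv]
    rw [e2]
    refine (isGreatest_opValuation_mulConj h hres A x⁻¹).unique ⟨?_, ?_⟩
    · obtain ⟨u, hu, hue⟩ := (isGreatest_opValuation h hres (B (δ x / x))).1
      exact ⟨u, hu, by simp only [e, ← hue]⟩
    · rintro _ ⟨u, hu, rfl⟩
      simp only [e]
      exact mul_le_mul_right (h.opApply_le _ hu) _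
  by_contra! H
  -- Put s = δx/x. If δ(b s)/b s were within distance 1 of s, then `b s` would solve the equation:
  -- |b| is unchanged when its argument moves by at most 1.
  have ht : ∀ x : K, x ≠ 0 →
      1 < O.valuation (δ (b (δ x / x)) / b (δ x / x) - δ x / x) := by
    intro x hx
    by_contra! hle
    refine H _ (hb0 (δ x / x)) (le_antisymm ?_ ?_)
    · have := hbcmp (δ (b (δ x / x)) / b (δ x / x)) (δ x / x) 1 (by simp)
        (by rwa [map_one, Valuation.map_sub_swap])
      simpa using this
    · have := hbcmp (δ x / x) (δ (b (δ x / x)) / b (δ x / x)) 1 (by simp) (by rwa [map_one])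
      simpa using this
  -- The image of the smaller ball's centre lies in the larger ball. Otherwise the two images would
  -- be infinitely far apart, and at least as far apart as the centres, against `hfar`.
  have hmeet : ∀ x z : K, x ≠ 0 → z ≠ 0 →
      O.valuation (δ (b (δ x / x)) / b (δ x / x) - δ x / x) ≤
        O.valuation (δ (b (δ z / z)) / b (δ z / z) - δ z / z) →
      O.valuation (δ (b (δ x / x)) / b (δ x / x) - δ z / z) ≤
        O.valuation (δ (b (δ z / z)) / b (δ z / z) - δ z / z) := by
    intro x z hx hz hxz
    have hz1 := ht z hz
    have hf := hfar (δ x / x) (δ z / z)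
    generalize δ x / x = sx at *
    generalize δ z / z = sz at *
    generalize δ (b sx) / b sx = p at *
    generalize δ (b sz) / b sz = q at *
    by_contra! hlt
    have hlt' : O.valuation (q - sz) < O.valuation (q - p) := by
      by_contra! hle
      have e : p - sz = (q - sz) - (q - p) := by ring
      rw [e] at hlt
      exact hlt.not_ge ((O.valuation.map_sub _ _).trans (max_le le_rfl hle))
    refine hf (hz1.trans hlt') ?_
    have e : sz - sx = (q - p) - (q - sz) + (p - sx) := by ring
    rw [e]
    exact Valuation.map_add_le _ ((O.valuation.map_sub _ _).trans (max_le le_rfl hlt'.le)) (hxz.trans hlt'.le)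
  obtain ⟨s, hs⟩ := hsph
    ((fun x : K => {c | O.valuation (c - δ x / x) ≤
      O.valuation (δ (b (δ x / x)) / b (δ x / x) - δ x / x)}) '' {x | x ≠ 0})
    ⟨_, 1, one_ne_zero, rfl⟩ (by rintro _ ⟨x, -, rfl⟩; exact ⟨_, _, rfl⟩) (by
      rintro _ ⟨x, hx, rfl⟩ _ ⟨z, hz, rfl⟩
      rcases le_total (O.valuation (δ (b (δ x / x)) / b (δ x / x) - δ x / x))
        (O.valuation (δ (b (δ z / z)) / b (δ z / z) - δ z / z)) with hle | hle
      · exact ⟨δ (b (δ x / x)) / b (δ x / x), le_refl (O.valuation _), hmeet x z hx hz hle⟩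
      · exact ⟨δ (b (δ z / z)) / b (δ z / z), hmeet z x hz hx hle, le_refl (O.valuation _)⟩)
  -- For the common point s, use the ball centred at its own image s' = δ(b s)/b s: the distance
  -- from s to s' is at most that from s' to its image, against `hfar`.
  have hsb := hs _ ⟨b s, hb0 s, rfl⟩
  refine hfar s (δ (b s) / b s) (ht _ (hb0 s)) ?_
  rw [Valuation.map_sub_swap]
  exact hsb

end Surjectivity

/-! ### Newton approximation and Zorn's lemma -/

section Zero

variable {K : Type w} [Field K] {O : ValuationSubring K} {δ : Derivation ℤ K K}

/-- The norm of a conjugate is a maximum over the ball |y| ≤ |g|, and the balls are nested. -/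
theorem opValuation_mulConj_mono (h : IsSmall O δ)
    (hres : IsLinearlySurjective (residueMap O δ h)) (A : ℕ →₀ K) {a g : K}
    (hag : O.valuation a ≤ O.valuation g) :
    opValuation O (mulConj δ A a) ≤ opValuation O (mulConj δ A g) := by
  rcases eq_or_ne g 0 with rfl | hg
  · rw [map_zero, le_zero_iff, map_eq_zero] at hag
    rw [hag]
  obtain ⟨u, hu, he⟩ := (isGreatest_opValuation_mulConj h hres A a).1
  rw [← he]
  refine (isGreatest_opValuation_mulConj h hres A g).2 ⟨a / g * u, ?_, ?_⟩
  · rw [mem_ofPred_eq, map_mul, map_div₀]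
    exact mul_le_one' (div_le_one_of_le₀ hag zero_le) hu
  · simp only [← mul_assoc, mul_div_cancel₀ _ hg]

theorem opValuation_mulConj_lt (h : IsSmall O δ)
    (hres : IsLinearlySurjective (residueMap O δ h)) (A : ℕ →₀ K) {a g : K}
    (hA : mulConj δ A g ≠ 0) (hag : O.valuation a < O.valuation g) :
    opValuation O (mulConj δ A a) < opValuation O (mulConj δ A g) := by
  have hg : g ≠ 0 := (O.valuation.ne_zero_iff).1 (zero_le.trans_lt hag).ne'
  obtain ⟨u, hu, he⟩ := (isGreatest_opValuation_mulConj h hres A a).1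
  rw [← he]
  have e : a * u = g * (a / g * u) := by field_simp
  simp only [e]
  rw [← opApply_mulConj]
  refine h.opApply_lt hA ?_
  rw [map_mul, map_div₀]
  refine mul_lt_one_of_nonneg_of_lt_one_left zero_le ?_ hu
  exact (div_lt_one₀ (zero_le.trans_lt hag)).2 hag

theorem valuation_opApply_le_mulConj (h : IsSmall O δ) (A : ℕ →₀ K) (a : K) :
    O.valuation (opApply δ A a) ≤ opValuation O (mulConj δ A a) := by
  have := h.opApply_le (mulConj δ A a) (y := 1) (by simp)
  rwa [opApply_mulConj, mul_one] at this

theorem opValuation_mulConj_one (h : IsSmall O δ)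
    (hres : IsLinearlySurjective (residueMap O δ h)) (A : ℕ →₀ K) :
    opValuation O (mulConj δ A 1) = opValuation O A := by
  have := isGreatest_opValuation_mulConj h hres A 1
  simp only [one_mul] at this
  exact this.unique (isGreatest_opValuation h hres A)

/-- A function that is linearly approximated on the maximal ideal and is small at `0` has a zero in
the maximal ideal. This holds over every spherically complete valued differential field with small
derivation and linearly surjective residue field, and for arbitrary functions `F`. -/
theorem exists_zero_of_linearlyApproximates (h : IsSmall O δ)
    (hres : IsLinearlySurjective (residueMap O δ h)) (hsph : IsSphericallyComplete O) {r : ℕ}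
    {F : (Fin (r + 1) → K) → K} {A : ℕ →₀ K}
    (hlin : LinearlyApproximates O δ F A {a | O.valuation a < 1})
    (hF : O.valuation (F 0) < opValuation O A) :
    ∃ ε : K, O.valuation ε < 1 ∧ F (jet δ r ε) = 0 ∧
      opValuation O (mulConj δ A ε) ≤ O.valuation (F 0) := by
  obtain ⟨hA, hlin⟩ := hlin
  have hjet : jet δ r 0 = 0 := by
    funext i
    exact Function.iterate_fixed (map_zero δ) _
  rw [← hjet] at hF ⊢
  obtain ⟨G, hG⟩ : ∃ G : K → K, ∀ a, G a = F (jet δ r a) := ⟨_, fun _ => rfl⟩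
  obtain ⟨N, hN⟩ : ∃ N : K → O.ValueGroup, ∀ a, N a = opValuation O (mulConj δ A a) :=
    ⟨_, fun _ => rfl⟩
  simp only [← hG, ← hN, mem_ofPred_eq] at hlin hF ⊢
  have hN0 : N 0 = 0 := by rw [hN, opValuation_mulConj_zero]
  have hN1 : N 1 = opValuation O A := by rw [hN, opValuation_mulConj_one h hres]
  have hmono : ∀ {a g : K}, O.valuation a ≤ O.valuation g → N a ≤ N g := fun hag => by
    rw [hN, hN]; exact opValuation_mulConj_mono h hres A hag
  have hlt : ∀ {a g : K}, N g ≠ 0 → O.valuation a < O.valuation g → N a < N g :=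
    fun {a g} hg hag => by
      rw [hN, hN]
      refine opValuation_mulConj_lt h hres A (fun h0 => hg ?_) hag
      rw [hN, h0, opValuation_zero]
  have hsurj : ∀ a, G a ≠ 0 → ∃ g, N g = O.valuation (G a) := fun a ha => by
    obtain ⟨g, -, hg⟩ := exists_opValuation_mulConj_eq h hres hsph hA ha
    exact ⟨g, by rw [hN, hg]⟩
  have hNadd : ∀ {a b : K} {c : O.ValueGroup}, N a ≤ c → N b ≤ c → N (a + b) ≤ c :=
    fun {a b c} ha hb => by
      rcases le_max_iff.1 (O.valuation.map_add a b) with hab | hab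
      · exact (hmono hab).trans ha
      · exact (hmono hab).trans hb
  have happ : ∀ a b : K, O.valuation a < 1 → O.valuation b < 1 →
      O.valuation (G b - G a - opApply δ A (b - a)) ≤ N (b - a) := by
    intro a b ha hb
    rcases eq_or_ne a b with rfl | hab
    · simp [opApply, Function.iterate_fixed (map_zero δ)]
    · exact (hlin a ha b hb hab).le
  have hle : ∀ {a b : K}, O.valuation a < 1 → O.valuation b < 1 → ∀ {c : O.ValueGroup},
      N (b - a) ≤ c → O.valuation (G a) ≤ c → O.valuation (G b) ≤ c := by
    intro a b ha hb c hc hac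
    have e : G b = (G b - G a - opApply δ A (b - a)) + opApply δ A (b - a) + G a := by ring
    rw [e]
    refine Valuation.map_add_le _ (Valuation.map_add_le _ ((happ a b ha hb).trans hc) ?_) hac
    refine le_trans ?_ hc
    rw [hN]; exact valuation_opApply_le_mulConj h A _
  have hN1' : N 1 ≠ 0 := by rw [hN1]; exact opValuation_ne_zero O hA
  have hGlt : ∀ a, O.valuation a < 1 → O.valuation (G a) < N 1 := by
    intro a ha
    refine (hle (a := 0) (by simp) ha (c := max (N a) (O.valuation (G 0)))
      (by rw [sub_zero]; exact le_max_left _ _) (le_max_right _ _)).trans_lt (max_lt ?_ ?_)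
    · exact hlt hN1' (by rwa [map_one])
    · rwa [hN1]
  -- If |b - a| ≥ 1, then N(b - a) ≥ N(1) > |G a|. So corrections stay in the maximal ideal.
  have hsmall : ∀ {a b : K}, O.valuation a < 1 → N (b - a) ≤ O.valuation (G a) →
      O.valuation b < 1 := by
    intro a b ha hb
    have : O.valuation (b - a) < 1 := by
      by_contra! h1
      rw [← map_one O.valuation] at h1
      exact ((hmono h1).trans hb).not_gt (hGlt a ha)
    have e : b = (b - a) + a := by ring
    rw [e]; exact Valuation.map_add_lt _ this ha
  -- Newton step: g is scaled so that N(g) = |G a|, and u solves A(gu) = -G(a) up to a smaller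
  -- error. The linear approximation error is also below |G a|.
  have himp : ∀ a, O.valuation a < 1 → G a ≠ 0 → ∃ b, O.valuation b < 1 ∧
      O.valuation (G b) < O.valuation (G a) ∧ N (b - a) ≤ O.valuation (G a) := by
    intro a ha hGa
    obtain ⟨g, hg⟩ := hsurj a hGa
    have hGv : O.valuation (G a) ≠ 0 := (O.valuation.ne_zero_iff).2 hGa
    have hAg : mulConj δ A g ≠ 0 := fun h0 => hGv (by rw [← hg, hN, h0, opValuation_zero])
    obtain ⟨u, hu, hlt'⟩ := exists_opApply_sub_lt h hres hAg (f := -G a)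
      (by rw [Valuation.map_neg, ← hg, hN])
    rw [opApply_mulConj, sub_neg_eq_add, ← hN, hg] at hlt'
    have hNu : N (g * u) ≤ O.valuation (G a) := by
      rw [← hg]
      refine hmono ?_
      rw [map_mul]; exact mul_le_of_le_one_right' hu
    have hb1 : O.valuation (a + g * u) < 1 := hsmall ha (by rwa [add_sub_cancel_left])
    refine ⟨a + g * u, hb1, ?_, by rwa [add_sub_cancel_left]⟩
    have e : G (a + g * u) = (G (a + g * u) - G a - opApply δ A (g * u)) +
      (opApply δ A (g * u) + G a) := by ring
    rw [e]
    refine Valuation.map_add_lt _ ?_ hlt'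
    rcases eq_or_ne (g * u) 0 with h0 | h0
    · simpa [h0, opApply, Function.iterate_fixed (map_zero δ)] using zero_lt_iff.2 hGv
    · have := hlin a ha (a + g * u) hb1 (by simpa using h0)
      rw [add_sub_cancel_left] at this
      exact this.trans_le hNu
  -- `R a b` says that b improves on a by a correction no larger, in terms of N, than the defect at
  -- a. Applied from 0 it carries the required bound on N(ε).
  let R : K → K → Prop := fun a b =>
    a = b ∨ (O.valuation (G b) < O.valuation (G a) ∧ N (b - a) ≤ O.valuation (G a))
  have hRtrans : ∀ {a b c}, R a b → R b c → R a c := by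
    rintro a b c (rfl | ⟨h1, h2⟩) (rfl | ⟨h3, h4⟩)
    · exact Or.inl rfl
    · exact Or.inr ⟨h3, h4⟩
    · exact Or.inr ⟨h1, h2⟩
    · refine Or.inr ⟨h3.trans h1, ?_⟩
      have e : c - a = (c - b) + (b - a) := by ring
      rw [e]; exact hNadd (h4.trans h1.le) h2
  have : Nonempty {a : K // O.valuation a < 1 ∧ R 0 a} := ⟨⟨0, by simp, Or.inl rfl⟩⟩
  have hub : ∀ C : Set {a : K // O.valuation a < 1 ∧ R 0 a}, IsChain (fun a b => R a.1 b.1) C →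
      C.Nonempty → ∃ ub : {a : K // O.valuation a < 1 ∧ R 0 a}, ∀ a ∈ C, R a ub := by
    intro C hC hCne
    have htotal : ∀ a ∈ C, ∀ b ∈ C, R a b ∨ R b a := by
      intro a ha b hb
      rcases eq_or_ne a b with rfl | hab
      · exact Or.inl (Or.inl rfl)
      · exact hC ha hb hab
    by_cases hmax : ∃ m ∈ C, ∀ a ∈ C, R a m
    · obtain ⟨m, -, hm⟩ := hmax
      exact ⟨m, hm⟩
    push Not at hmax
    have hnext : ∀ a ∈ C, ∃ a' ∈ C, O.valuation (G a') < O.valuation (G a) := by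
      intro a ha
      obtain ⟨a', ha', hna⟩ := hmax a ha
      refine ⟨a', ha', ?_⟩
      rcases htotal a ha a' ha' with hR | hR
      · rcases hR with heq | ⟨hR, -⟩
        · exact absurd (Or.inl heq.symm) hna
        · exact hR
      · exact absurd hR hna
    have hGne : ∀ a ∈ C, G a ≠ 0 := by
      intro a ha h0
      obtain ⟨a', -, hlt'⟩ := hnext a ha
      rw [h0, map_zero] at hlt'
      exact not_lt_zero hlt'
    have hg : ∀ a : C, ∃ g, N g = O.valuation (G a) := fun a => hsurj _ (hGne a a.2)
    choose g hg using hg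
    -- Strict monotonicity of N and attainment of |G a| make the condition N(b - a) ≤ |G a| define a
    -- genuine valuation ball.
    have hball : ∀ (a : C) (b : K), O.valuation (b - a) ≤ O.valuation (g a) ↔
        N (b - a) ≤ O.valuation (G a) := by
      intro a b
      rw [← hg]
      refine ⟨hmono, fun hle' => ?_⟩
      by_contra! hlt'
      refine hle'.not_gt (hlt (fun h0 => ?_) hlt')
      have h1 := hmono hlt'.le
      rw [h0, le_zero_iff, hg] at h1
      exact (O.valuation.ne_zero_iff).2 (hGne a a.2) h1
    have hRball : ∀ a b : C, R a b → O.valuation ((b : K) - a) ≤ O.valuation (g a) := by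
      rintro a b (heq | ⟨-, hR⟩)
      · rw [heq, sub_self, map_zero]; exact zero_le
      · exact (hball a b).2 hR
    have hself : ∀ a : C, O.valuation ((a : K) - a) ≤ O.valuation (g a) :=
      fun a => hRball a a (Or.inl rfl)
    obtain ⟨a₀, ha₀⟩ := hCne
    obtain ⟨c, hc⟩ := hsph (range fun a : C => {b : K | O.valuation (b - a) ≤ O.valuation (g a)})
      ⟨_, ⟨a₀, ha₀⟩, rfl⟩ (by rintro _ ⟨a, rfl⟩; exact ⟨_, _, rfl⟩) (by
        rintro _ ⟨a, rfl⟩ _ ⟨b, rfl⟩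
        rcases htotal a a.2 b b.2 with hR | hR
        · exact ⟨b, hRball a b hR, hself b⟩
        · exact ⟨a, hself a, hRball b a hR⟩)
    have hcN : ∀ a : C, N (c - a) ≤ O.valuation (G a) := fun a =>
      (hball a c).1 (hc _ ⟨a, rfl⟩)
    have hc1 : O.valuation c < 1 := hsmall a₀.2.1 (hcN ⟨a₀, ha₀⟩)
    -- Membership in the ball of a gives only |G c| ≤ |G a|; strictness comes from a member a' of
    -- the chain with smaller defect.
    have hRc : ∀ a ∈ C, R a c := by
      intro a ha
      obtain ⟨a', ha', hlt'⟩ := hnext a ha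
      exact Or.inr ⟨(hle a'.2.1 hc1 (hcN ⟨a', ha'⟩) le_rfl).trans_lt hlt', hcN ⟨a, ha⟩⟩
    exact ⟨⟨c, hc1, hRtrans a₀.2.2 (hRc a₀ ha₀)⟩, hRc⟩
  obtain ⟨⟨m, hm1, hRm⟩, hm⟩ := exists_maximal_of_nonempty_chains_bounded
    (α := {a : K // O.valuation a < 1 ∧ R 0 a}) (r := fun a b => R a b) hub (fun {a b c} => hRtrans)
  refine ⟨m, hm1, ?_, ?_⟩
  · by_contra hGm
    obtain ⟨b, hb1, hbG, hbN⟩ := himp m hm1 hGm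
    have hRb : R m b := Or.inr ⟨hbG, hbN⟩
    rcases hm ⟨b, hb1, hRtrans hRm hRb⟩ hRb with hbm | ⟨hbm, -⟩
    · simp only at hbm
      rw [hbm] at hbG
      exact lt_irrefl _ hbG
    · exact hbG.not_gt hbm
  · rcases hRm with rfl | ⟨-, h2⟩
    · rw [hN0]; exact zero_le
    · rwa [sub_zero] at h2

end Zero
end TConvex

end

/-- Let `T` be a complete, model complete, power bounded o-minimal theory extending the theory of
real closed ordered fields, and let `K` be a model of `T` with a proper `T`-convex valuation ring
`O` and a small `T`-derivation `δ`. If the differential residue field is linearly surjective and `K`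
is spherically complete, then `K` is `T^∂`-henselian. -/
theorem mainTheorem10 {L : FirstOrder.Language.{u, v}} (S : TConvex.OrderedRingSymbols L)
    (T : L.Theory) (hcomplete : T.IsComplete)
    (hmodelComplete : TConvex.IsModelComplete.{u, v, w} T)
    (hRCOF : TConvex.ExtendsRCOF.{u, v, w} S T)
    (homin : TConvex.IsOMinimal.{u, v, w} S T)
    (hpower : TConvex.IsPowerBounded.{u, v, w} S T)
    (K : Type w) [Field K] [LinearOrder K] [IsStrictOrderedRing K]
    [TopologicalSpace K] [OrderTopology K] [L.Structure K] (hK : S.Compatible K) [T.Model K]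
    (O : ValuationSubring K) (hproper : O ≠ ⊤) (hconvex : TConvex.IsTConvex L (O : Set K))
    (δ : Derivation ℤ K K) (hder : TConvex.IsTDerivation L δ) (hsmall : TConvex.IsSmall O δ)
    (hres : TConvex.IsLinearlySurjective (TConvex.residueMap O δ hsmall))
    (hsph : TConvex.IsSphericallyComplete O) :
    TConvex.IsTDHenselian L O δ hsmall :=
  ⟨hres, fun _ _ _ _ hlin hF =>
    TConvex.exists_zero_of_linearlyApproximates hsmall hres hsph hlin hF⟩
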